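/- A cube in $\mathbb{R}^n$ means a cube with sides parallel to the axes, $l(Q)$ is the sidelength of a cube $Q$, and two cubes $Q,Q'$ with $l(Q)=l(Q')$ are called consecutive if the intersection of their closures is one of their ($(n-1)$-dimensional) faces. Write $|\cdot|$ for Lebesgue measure. A measurable set $A\subset\mathbb{R}^n$ is called smooth if \[\lim_{\delta\to0^+}\ \sup\left|\frac{|A\cap Q|}{|Q|}-\frac{|A\cap Q'|}{|Q'|}\right|=0,\] where the supremum is taken over all pairs of consecutive cubes $Q,Q'$ with $l(Q)=l(Q')\le\delta$. Theorem. Let $\phi:\mathbb{R}^n\to\mathbb{R}^n$ be a $\mathcal{C}^1$ map that is bilipschitz, i.e. there is a constant $C\ge1$ with $C^{-1}\|x-y\|\le\|\phi(x)-\phi(y)\|\le C\|x-y\|$ for all $x,y\in\mathbb{R}^n$, and whose Jacobian $J\phi=\det D\phi$ is uniformly continuous on $\mathbb{R}^n$. Let $A\subset\mathbb{R}^n$ be a measurable set. Then the following are equivalent: (a) $A$ is a smooth set; (b) $\phi^{-1}(A)$ is a smooth set; (c) $A$ verifies the smoothness condition with the cubes replaced by their images under $\phi$, that is, \[\lim_{\delta\to0^+}\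 \sup\left|\frac{|A\cap\phi(Q)|}{|\phi(Q)|}-\frac{|A\cap\phi(Q')|}{|\phi(Q')|}\right|=0,\] where the supremum is taken over all pairs of consecutive cubes $Q,Q'$ with $l(Q)=l(Q')\le\delta$. -/

import Mathlib

open MeasureTheory Filter Topology
open scoped ENNReal

noncomputable section

namespace SmoothSets

/-- The (closed) cube in `ℝⁿ` with sides parallel to the axes, lower corner `a` and sidelength `l`.
Its boundary is a Lebesgue null set. -/
def cube {n : ℕ} (a : EuclideanSpace ℝ (Fin n)) (l : ℝ) : Set (EuclideanSpace ℝ (Fin n)) :=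
  {x | ∀ i, x i ∈ Set.Icc (a i) (a i + l)}

/-- `F` is one of the `2n` faces (of dimension `n - 1`) of the cube with lower corner `a` and
sidelength `l`. -/
def IsFace {n : ℕ} (F : Set (EuclideanSpace ℝ (Fin n))) (a : EuclideanSpace ℝ (Fin n)) (l : ℝ) :
    Prop :=
  ∃ i, F = {x ∈ cube a l | x i = a i} ∨ F = {x ∈ cube a l | x i = a i + l}

/-- The cubes with lower corners `a` and `b` and the same sidelength `l > 0` are consecutive: their
intersection is a face of both of them. -/
def Consecutive {n : ℕ} (a b : EuclideanSpace ℝ (Fin n)) (l : ℝ) : Prop :=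
  0 < l ∧ IsFace (cube a l ∩ cube b l) a l ∧ IsFace (cube a l ∩ cube b l) b l

/-- The density `|A ∩ S| / |S|` of `A` in `S`. -/
def density {n : ℕ} (A S : Set (EuclideanSpace ℝ (Fin n))) : ℝ :=
  volume.real (A ∩ S) / volume.real S

/-- The supremum of `|D(Q) - D(Q')|` over all pairs of consecutive cubes `Q`, `Q'` with
`l(Q) = l(Q') ≤ δ`, where `D` is the density of `A`. -/
def modulus {n : ℕ} (A : Set (EuclideanSpace ℝ (Fin n))) (δ : ℝ) : ℝ≥0∞ :=
  ⨆ (a : EuclideanSpace ℝ (Fin n)) (b : EuclideanSpace ℝ (Fin n)) (l : ℝ)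
    (_ : Consecutive a b l) (_ : l ≤ δ),
    ENNReal.ofReal |density A (cube a l) - density A (cube b l)|

/-- The same supremum, with the cubes `Q`, `Q'` replaced by their images `φ(Q)`, `φ(Q')`. -/
def imageModulus {n : ℕ} (φ : EuclideanSpace ℝ (Fin n) → EuclideanSpace ℝ (Fin n))
    (A : Set (EuclideanSpace ℝ (Fin n))) (δ : ℝ) : ℝ≥0∞ :=
  ⨆ (a : EuclideanSpace ℝ (Fin n)) (b : EuclideanSpace ℝ (Fin n)) (l : ℝ)
    (_ : Consecutive a b l) (_ : l ≤ δ),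
    ENNReal.ofReal |density A (φ '' cube a l) - density A (φ '' cube b l)|

/-- `A` is a smooth set: it is Lebesgue measurable and the differences of its densities in
consecutive cubes tend to zero, uniformly, as the sidelength tends to zero. -/
def IsSmooth {n : ℕ} (A : Set (EuclideanSpace ℝ (Fin n))) : Prop :=
  NullMeasurableSet A volume ∧ Tendsto (modulus A) (𝓝[>] 0) (𝓝 0)

/-- `A` is Lebesgue measurable and verifies the smoothness condition with the images of the cubes
under `φ` in place of the cubes. -/
def IsSmoothForImages {n : ℕ} (φ : EuclideanSpace ℝ (Fin n) → EuclideanSpace ℝ (Fin n))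
    (A : Set (EuclideanSpace ℝ (Fin n))) : Prop :=
  NullMeasurableSet A volume ∧ Tendsto (imageModulus φ A) (𝓝[>] 0) (𝓝 0)

/-- `φ` is bilipschitz for the Euclidean norm. -/
def IsBilipschitz {n : ℕ} (φ : EuclideanSpace ℝ (Fin n) → EuclideanSpace ℝ (Fin n)) : Prop :=
  ∃ C : ℝ, 1 ≤ C ∧ ∀ x y, C⁻¹ * ‖x - y‖ ≤ ‖φ x - φ y‖ ∧ ‖φ x - φ y‖ ≤ C * ‖x - y‖

/-- The Jacobian (determinant of the differential) of `φ` at `x`. -/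
def jacobian {n : ℕ} (φ : EuclideanSpace ℝ (Fin n) → EuclideanSpace ℝ (Fin n))
    (x : EuclideanSpace ℝ (Fin n)) : ℝ :=
  (fderiv ℝ φ x).det

end SmoothSets

end

/-!
Let `C` be a bilipschitz constant of `φ`. That `φ⁻¹(A)` is smooth if and only if `A` is smooth for
images of cubes is a change of variables: `|J φ|` is bounded below by `C⁻ⁿ` and uniformly
continuous, so on a small cube `Q` it is nearly constant, and the density of `A` in `φ(Q)` is
uniformly close to that of `φ⁻¹(A)` in `Q` (`exists_abs_density_image_sub_le`).

That a smooth set is smooth for images of cubes is a multiscale argument. Let `S = φ(Q)`, let `R` be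
a cube containing `S` with sidelength comparable to that of `Q`, and write `d(P)` for the density of
`A` in `P`. The quantity `|A ∩ S ∩ P| - d(P) |S ∩ P|` (`discrepancy`) of a cube `P` is the sum of the
same quantities over the `2ⁿ` dyadic children `P'` of `P` and of the terms `(d(P') - d(P)) |S ∩ P'|`.
If `P` is contained in `S` or disjoint from it, the discrepancy vanishes. Otherwise smoothness bounds
these terms by a multiple of `ε |P|`, and `P` lies in the image of a shell around `∂Q` whose width is
comparable to the sidelength of `P`. The dyadic subcubes of generation `k` of `R` that meet both `S`
and its complement thus have total volume `O(2⁻ᵏ |S|)`, and summing over `k` gives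
`|d(S) - d(R)| = O(ε)` (`abs_discrepancy_le_sum`, `exists_abs_density_image_sub_density_le`). Two
consecutive cubes can use the same `R`, so the densities of `A` in their images differ by `O(ε)`.

Finally `φ` is a diffeomorphism whose inverse satisfies the same hypotheses (`exists_inverse`), and
smoothness of `φ⁻¹(A)` passes to `A` because `A` is the preimage of `φ⁻¹(A)` under `φ⁻¹`.
-/

namespace SmoothSets

variable {n : ℕ} {A : Set (EuclideanSpace ℝ (Fin n))} {δ ε C : ℝ}
  {φ ψ : EuclideanSpace ℝ (Fin n) → EuclideanSpace ℝ (Fin n)}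

/-! ### Cubes -/

theorem measurableSet_cube (a : EuclideanSpace ℝ (Fin n)) (l : ℝ) : MeasurableSet (cube a l) := by
  have : cube a l = ⋂ i, {x : EuclideanSpace ℝ (Fin n) | x i ∈ Set.Icc (a i) (a i + l)} := by
    ext x; simp [cube]
  rw [this]
  refine MeasurableSet.iInter fun i => ?_
  exact (by fun_prop : Measurable fun x : EuclideanSpace ℝ (Fin n) => x i) measurableSet_Icc

theorem volume_cube (a : EuclideanSpace ℝ (Fin n)) (l : ℝ) :
    volume (cube a l) = ENNReal.ofReal l ^ n := by
  have h := (EuclideanSpace.volume_preserving_symm_measurableEquiv_toLp (Fin n)).measure_preimage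
    (measurableSet_Icc (a := fun i => a i) (b := fun i => a i + l)).nullMeasurableSet
  rw [Real.volume_Icc_pi] at h
  simp only [add_sub_cancel_left, Finset.prod_const, Finset.card_univ, Fintype.card_fin] at h
  rw [← h]
  congr 1
  ext x
  simp [cube, Pi.le_def, forall_and]

theorem volume_real_cube (a : EuclideanSpace ℝ (Fin n)) {l : ℝ} (hl : 0 ≤ l) :
    volume.real (cube a l) = l ^ n := by
  rw [Measure.real, volume_cube, ENNReal.toReal_pow, ENNReal.toReal_ofReal hl]

theorem volume_cube_ne_top (a : EuclideanSpace ℝ (Fin n)) (l : ℝ) : volume (cube a l) ≠ ∞ := by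
  rw [volume_cube]; finiteness

theorem volume_inter_cube_ne_top (B : Set (EuclideanSpace ℝ (Fin n)))
    (a : EuclideanSpace ℝ (Fin n)) (l : ℝ) : volume (B ∩ cube a l) ≠ ∞ :=
  measure_ne_top_of_subset Set.inter_subset_right (volume_cube_ne_top a l)

theorem volume_hyperplane (i : Fin n) (c : ℝ) :
    volume {x : EuclideanSpace ℝ (Fin n) | x i = c} = 0 := by
  have hm : MeasurableSet {f : Fin n → ℝ | f i = c} :=
    measurableSet_eq_fun (measurable_pi_apply i) measurable_const
  have h := (EuclideanSpace.volume_preserving_symm_measurableEquiv_toLp (Fin n)).measure_preimage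
    hm.nullMeasurableSet
  rw [volume_pi, Measure.pi_hyperplane] at h
  exact h

theorem norm_le_sqrt_mul {x : EuclideanSpace ℝ (Fin n)} {r : ℝ} (hr : 0 ≤ r)
    (h : ∀ i, |x i| ≤ r) : ‖x‖ ≤ √n * r := by
  rw [EuclideanSpace.norm_eq]
  calc √(∑ i, ‖x i‖ ^ 2) ≤ √(∑ _i : Fin n, r ^ 2) := by
        gcongr with i
        simpa using h i
    _ = √n * r := by
        simp [Real.sqrt_sq hr]

theorem norm_sub_le_of_mem_cube {a x y : EuclideanSpace ℝ (Fin n)} {l : ℝ} (hx : x ∈ cube a l)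
    (hy : y ∈ cube a l) : ‖x - y‖ ≤ √n * l := by
  rcases n.eq_zero_or_pos with rfl | hn
  · simp [Subsingleton.elim x y]
  have hl : 0 ≤ l := by
    have := hx ⟨0, hn⟩
    linarith [this.1.trans this.2]
  refine norm_le_sqrt_mul hl fun i => ?_
  have h1 := hx i
  have h2 := hy i
  simp only [Set.mem_Icc] at h1 h2
  simp only [PiLp.sub_apply, abs_le]
  constructor <;> linarith [h1.1, h1.2, h2.1, h2.2]

theorem abs_sub_apply_le (x y : EuclideanSpace ℝ (Fin n)) (i : Fin n) : |x i - y i| ≤ ‖x - y‖ := by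
  simpa using PiLp.norm_apply_le (x - y) i

/-- Two consecutive cubes have a common point. -/
theorem Consecutive.abs_sub_le {a b : EuclideanSpace ℝ (Fin n)} {l : ℝ} (h : Consecutive a b l)
    (i : Fin n) : |a i - b i| ≤ l := by
  obtain ⟨hl, ⟨j, hj⟩, -⟩ := h
  have hne : (cube a l ∩ cube b l).Nonempty := by
    rcases hj with hj | hj
    · rw [hj]
      exact ⟨a, fun i => ⟨le_rfl, by linarith⟩, rfl⟩
    · rw [hj]
      exact ⟨WithLp.toLp 2 fun i => a i + l, fun i => ⟨by simp [hl.le], by simp⟩, by simp⟩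
  obtain ⟨x, hxa, hxb⟩ := hne
  have h1 := hxa i
  have h2 := hxb i
  simp only [Set.mem_Icc] at h1 h2
  rw [abs_le]
  constructor <;> linarith [h1.1, h1.2, h2.1, h2.2]

/-- Lower corner of the dyadic child, indexed by the set `T` of coordinates in which the upper half
is taken, of the cube with lower corner `a` and sidelength `2 * s`. -/
noncomputable def childCorner (a : EuclideanSpace ℝ (Fin n)) (s : ℝ) (T : Finset (Fin n)) :
    EuclideanSpace ℝ (Fin n) :=
  WithLp.toLp 2 fun i => a i + if i ∈ T then s else 0

theorem childCorner_apply (a : EuclideanSpace ℝ (Fin n)) (s : ℝ) (T : Finset (Fin n)) (i : Fin n) :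
    childCorner a s T i = a i + if i ∈ T then s else 0 := rfl

theorem iUnion_cube_childCorner (a : EuclideanSpace ℝ (Fin n)) {s : ℝ} (hs : 0 ≤ s) :
    ⋃ T : Finset (Fin n), cube (childCorner a s T) s = cube a (2 * s) := by
  classical
  ext x
  simp only [Set.mem_iUnion]
  constructor
  · rintro ⟨T, hT⟩ i
    have := hT i
    rw [childCorner_apply, Set.mem_Icc] at this
    split_ifs at this <;> constructor <;> linarith [this.1, this.2]
  · intro hx
    refine ⟨Finset.univ.filter fun i => a i + s ≤ x i, fun i => ?_⟩
    have := hx i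
    rw [Set.mem_Icc] at this
    rw [childCorner_apply, Set.mem_Icc]
    simp only [Finset.mem_filter, Finset.mem_univ, true_and]
    split_ifs with h <;> constructor <;> linarith [this.1, this.2]

theorem aedisjoint_cube_childCorner (a : EuclideanSpace ℝ (Fin n)) (s : ℝ) :
    Pairwise (Function.onFun (AEDisjoint volume)
      fun T : Finset (Fin n) => cube (childCorner a s T) s) := by
  intro T U hTU
  obtain ⟨i, hi⟩ : ∃ i, ¬(i ∈ T ↔ i ∈ U) := by
    by_contra! h
    exact hTU (Finset.ext h)
  refine measure_mono_null (fun x hx => ?_) (volume_hyperplane i (a i + s))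
  have h1 := hx.1 i
  have h2 := hx.2 i
  rw [childCorner_apply, Set.mem_Icc] at h1 h2
  simp only [Set.mem_ofPred_eq]
  by_cases hT : i ∈ T <;> by_cases hU : i ∈ U <;> simp only [hT, hU, if_true, if_false] at h1 h2 hi
  · simp at hi
  · linarith [h1.1, h2.2]
  · linarith [h1.2, h2.1]
  · simp at hi

/-- No measurability of `B` is needed, as the cubes are measurable. -/
theorem volume_real_inter_cube_eq_sum (B : Set (EuclideanSpace ℝ (Fin n)))
    (a : EuclideanSpace ℝ (Fin n)) {s : ℝ} (hs : 0 ≤ s) :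
    volume.real (B ∩ cube a (2 * s)) =
      ∑ T : Finset (Fin n), volume.real (B ∩ cube (childCorner a s T) s) := by
  have hB (x : EuclideanSpace ℝ (Fin n)) (l : ℝ) :
      (volume.restrict B) (cube x l) = volume (B ∩ cube x l) := by
    rw [Measure.restrict_apply (measurableSet_cube x l), Set.inter_comm]
  have key : volume (B ∩ cube a (2 * s)) =
      ∑ T : Finset (Fin n), volume (B ∩ cube (childCorner a s T) s) := by
    rw [← hB, ← iUnion_cube_childCorner a hs, measure_iUnion₀
      (fun T U hTU => Measure.absolutelyContinuous_of_le Measure.restrict_le_self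
        (aedisjoint_cube_childCorner a s hTU))
      (fun T => (measurableSet_cube _ _).nullMeasurableSet), tsum_fintype]
    simp_rw [hB]
  rw [Measure.real, key, ENNReal.toReal_sum fun T _ => volume_inter_cube_ne_top B _ _]
  rfl

theorem consecutive_childCorner_insert (a : EuclideanSpace ℝ (Fin n)) {s : ℝ} (hs : 0 < s)
    {T : Finset (Fin n)} {i : Fin n} (hi : i ∉ T) :
    Consecutive (childCorner a s T) (childCorner a s (insert i T)) s := by
  have h1 : childCorner a s (insert i T) i = childCorner a s T i + s := by
    simp [childCorner_apply, hi]
  have h2 (j : Fin n) (hj : j ≠ i) : childCorner a s (insert i T) j = childCorner a s T j := by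
    simp [childCorner_apply, hj]
  refine ⟨hs, ⟨i, Or.inr ?_⟩, ⟨i, Or.inl ?_⟩⟩
  · ext x
    refine ⟨fun hx => ⟨hx.1, le_antisymm (hx.1 i).2 (h1 ▸ (hx.2 i).1)⟩, fun hx => ⟨hx.1, fun j => ?_⟩⟩
    by_cases hj : j = i
    · subst hj
      rw [h1, hx.2]
      constructor <;> linarith
    · rw [h2 j hj]
      exact hx.1 j
  · ext x
    refine ⟨fun hx => ⟨hx.2, le_antisymm (h1 ▸ (hx.1 i).2) (hx.2 i).1⟩, fun hx => ⟨fun j => ?_, hx.1⟩⟩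
    by_cases hj : j = i
    · subst hj
      rw [hx.2, h1]
      constructor <;> linarith
    · rw [← h2 j hj]
      exact hx.1 j

/-! ### Densities in dyadic subcubes -/

theorem density_nonneg (A S : Set (EuclideanSpace ℝ (Fin n))) : 0 ≤ density A S :=
  div_nonneg measureReal_nonneg measureReal_nonneg

theorem density_cube_le_one (A : Set (EuclideanSpace ℝ (Fin n))) (a : EuclideanSpace ℝ (Fin n))
    (l : ℝ) : density A (cube a l) ≤ 1 :=
  div_le_one_of_le₀ (measureReal_mono Set.inter_subset_right (volume_cube_ne_top a l))
    measureReal_nonneg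

theorem density_mul_volume_real {A S : Set (EuclideanSpace ℝ (Fin n))} (hS : volume.real S ≠ 0) :
    density A S * volume.real S = volume.real (A ∩ S) :=
  div_mul_cancel₀ _ hS

/-- Raising the coordinates of `T` one at a time passes through consecutive cubes. -/
theorem abs_density_childCorner_sub_le
    (h : ∀ a b l, Consecutive a b l → l ≤ δ → |density A (cube a l) - density A (cube b l)| ≤ ε)
    (hε : 0 ≤ ε) (a : EuclideanSpace ℝ (Fin n)) {s : ℝ} (hs : 0 < s) (hsδ : s ≤ δ)
    (T : Finset (Fin n)) :
    |density A (cube (childCorner a s T) s) - density A (cube (childCorner a s ∅) s)| ≤ n * ε := by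
  have key : |density A (cube (childCorner a s T) s) - density A (cube (childCorner a s ∅) s)|
      ≤ T.card * ε := by
    induction T using Finset.induction_on with
    | empty => simp
    | insert i T hi ih =>
      rw [Finset.card_insert_of_notMem hi]
      have := h _ _ s (consecutive_childCorner_insert a hs hi) hsδ
      rw [abs_sub_comm] at this
      push_cast
      linarith [abs_sub_le (density A (cube (childCorner a s (insert i T)) s))
        (density A (cube (childCorner a s T) s)) (density A (cube (childCorner a s ∅) s))]
  refine key.trans ?_
  gcongr
  simpa using T.card_le_univ

/-- The density in a cube is the average of the densities in its `2 ^ n` dyadic children, so it is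
within `2 * n * ε` of each of them. -/
theorem abs_density_childCorner_sub_density_le
    (h : ∀ a b l, Consecutive a b l → l ≤ δ → |density A (cube a l) - density A (cube b l)| ≤ ε)
    (hε : 0 ≤ ε) (a : EuclideanSpace ℝ (Fin n)) {s : ℝ} (hs : 0 < s) (hsδ : s ≤ δ)
    (T : Finset (Fin n)) :
    |density A (cube (childCorner a s T) s) - density A (cube a (2 * s))| ≤ 2 * n * ε := by
  set d : Finset (Fin n) → ℝ := fun T => density A (cube (childCorner a s T) s) with hd
  have hpos : (0 : ℝ) < s ^ n := by positivity
  have hsum : density A (cube a (2 * s)) * 2 ^ n = ∑ T, d T := by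
    have h1 : density A (cube a (2 * s)) * volume.real (cube a (2 * s)) = ∑ T, d T * s ^ n := by
      rw [density_mul_volume_real (by rw [volume_real_cube a (by positivity)]; positivity),
        volume_real_inter_cube_eq_sum A a hs.le]
      refine Finset.sum_congr rfl fun U _ => ?_
      rw [hd, ← volume_real_cube (childCorner a s U) hs.le, density_mul_volume_real]
      rw [volume_real_cube _ hs.le]; exact hpos.ne'
    rw [volume_real_cube a (by positivity), mul_pow, ← Finset.sum_mul, ← mul_assoc] at h1
    exact mul_right_cancel₀ hpos.ne' h1
  have h2 : |d ∅ - density A (cube a (2 * s))| ≤ n * ε := by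
    have h3 : (d ∅ - density A (cube a (2 * s))) * 2 ^ n = ∑ T, (d ∅ - d T) := by
      rw [Finset.sum_sub_distrib, ← hsum]
      simp
      ring
    have h4 : |d ∅ - density A (cube a (2 * s))| * 2 ^ n ≤ n * ε * 2 ^ n := by
      calc _ = |∑ T, (d ∅ - d T)| := by rw [← h3, abs_mul, abs_of_pos (by positivity : (0:ℝ) < 2 ^ n)]
        _ ≤ ∑ T, |d ∅ - d T| := Finset.abs_sum_le_sum_abs _ _
        _ ≤ ∑ _T : Finset (Fin n), n * ε := Finset.sum_le_sum fun U _ => by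
            rw [abs_sub_comm]; exact abs_density_childCorner_sub_le h hε a hs hsδ U
        _ = n * ε * 2 ^ n := by simp; ring
    exact le_of_mul_le_mul_right h4 (by positivity)
  have h5 := abs_density_childCorner_sub_le h hε a hs hsδ T
  linarith [abs_sub_le (d T) (d ∅) (density A (cube a (2 * s)))]

/-- Discrepancy, on the cube with lower corner `p` and sidelength `s`, between the measure of
`A ∩ S` and its prediction from the measure of `S` and the density of `A` in that cube. -/
noncomputable def discrepancy (A S : Set (EuclideanSpace ℝ (Fin n))) (p : EuclideanSpace ℝ (Fin n))
    (s : ℝ) : ℝ :=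
  volume.real ((A ∩ S) ∩ cube p s) - density A (cube p s) * volume.real (S ∩ cube p s)

theorem discrepancy_eq_zero_of_subset {S : Set (EuclideanSpace ℝ (Fin n))}
    {p : EuclideanSpace ℝ (Fin n)} {s : ℝ} (hs : 0 < s) (h : cube p s ⊆ S) :
    discrepancy A S p s = 0 := by
  rw [discrepancy, Set.inter_assoc, Set.inter_eq_right.2 h, density_mul_volume_real, sub_self]
  rw [volume_real_cube p hs.le]
  positivity

theorem discrepancy_eq_zero_of_disjoint {S : Set (EuclideanSpace ℝ (Fin n))}
    {p : EuclideanSpace ℝ (Fin n)} {s : ℝ} (h : Disjoint (cube p s) S) :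
    discrepancy A S p s = 0 := by
  rw [discrepancy, Set.inter_assoc, Set.inter_comm S, h.inter_eq]
  simp

theorem abs_discrepancy_le (S : Set (EuclideanSpace ℝ (Fin n)))
    (p : EuclideanSpace ℝ (Fin n)) (s : ℝ) :
    |discrepancy A S p s| ≤ volume.real (cube p s) := by
  have h1 : volume.real ((A ∩ S) ∩ cube p s) ≤ volume.real (cube p s) :=
    measureReal_mono Set.inter_subset_right (volume_cube_ne_top p s)
  have h2 : volume.real (S ∩ cube p s) ≤ volume.real (cube p s) :=
    measureReal_mono Set.inter_subset_right (volume_cube_ne_top p s)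
  have h3 : density A (cube p s) * volume.real (S ∩ cube p s) ≤ 1 * volume.real (cube p s) :=
    mul_le_mul (density_cube_le_one A p s) h2 measureReal_nonneg zero_le_one
  have h4 : 0 ≤ density A (cube p s) * volume.real (S ∩ cube p s) :=
    mul_nonneg (density_nonneg _ _) measureReal_nonneg
  have h5 : 0 ≤ volume.real ((A ∩ S) ∩ cube p s) := measureReal_nonneg
  rw [discrepancy, abs_le]
  constructor <;> linarith

theorem discrepancy_eq_sum (S : Set (EuclideanSpace ℝ (Fin n)))
    (p : EuclideanSpace ℝ (Fin n)) {s : ℝ} (hs : 0 ≤ s) :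
    discrepancy A S p (2 * s) = ∑ T, discrepancy A S (childCorner p s T) s +
      ∑ T, (density A (cube (childCorner p s T) s) - density A (cube p (2 * s))) *
        volume.real (S ∩ cube (childCorner p s T) s) := by
  simp only [discrepancy]
  rw [volume_real_inter_cube_eq_sum _ p hs, volume_real_inter_cube_eq_sum _ p hs, Finset.mul_sum,
    ← Finset.sum_sub_distrib, ← Finset.sum_add_distrib]
  exact Finset.sum_congr rfl fun T _ => by ring

/-- Multiscale estimate: `N s` contains all the cubes of sidelength `s` that meet both `S` and its
complement, and only those contribute when the density in a cube is compared with the densities in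
its dyadic children. -/
theorem abs_discrepancy_le_sum
    (h : ∀ a b l, Consecutive a b l → l ≤ δ → |density A (cube a l) - density A (cube b l)| ≤ ε)
    (hε : 0 ≤ ε) {S : Set (EuclideanSpace ℝ (Fin n))} {N : ℝ → Set (EuclideanSpace ℝ (Fin n))}
    (hN : ∀ p s, 0 < s → cube p s ⊆ S ∨ Disjoint (cube p s) S ∨ cube p s ⊆ N s)
    (K : ℕ) (p : EuclideanSpace ℝ (Fin n)) {s : ℝ} (hs : 0 < s) (hsδ : s ≤ δ) :
    |discrepancy A S p s| ≤
      2 * n * ε * ∑ k ∈ Finset.range K, volume.real (N (s / 2 ^ k) ∩ cube p s) +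
        volume.real (N (s / 2 ^ K) ∩ cube p s) := by
  have hzero (p : EuclideanSpace ℝ (Fin n)) (s : ℝ) (K : ℕ) : 0 ≤
      2 * n * ε * ∑ k ∈ Finset.range K, volume.real (N (s / 2 ^ k) ∩ cube p s) +
        volume.real (N (s / 2 ^ K) ∩ cube p s) := by positivity
  induction K generalizing p s with
  | zero =>
    rcases hN p s hs with h1 | h1 | h1
    · rw [discrepancy_eq_zero_of_subset hs h1, abs_zero]; exact hzero p s 0
    · rw [discrepancy_eq_zero_of_disjoint h1, abs_zero]; exact hzero p s 0
    · simpa [Set.inter_eq_right.2 h1] using abs_discrepancy_le S p s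
  | succ K ih =>
    rcases hN p s hs with h1 | h1 | h1
    · rw [discrepancy_eq_zero_of_subset hs h1, abs_zero]; exact hzero p s _
    · rw [discrepancy_eq_zero_of_disjoint h1, abs_zero]; exact hzero p s _
    obtain ⟨r, rfl⟩ : ∃ r, s = 2 * r := ⟨s / 2, by ring⟩
    have hr : 0 < r := by linarith
    have hrδ : r ≤ δ := by linarith
    have hpow (k : ℕ) : 2 * r / 2 ^ (k + 1) = r / 2 ^ k := by
      rw [pow_succ]; field_simp
    rw [discrepancy_eq_sum S p hr.le]
    have hfirst : |∑ T, discrepancy A S (childCorner p r T) r| ≤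
        2 * n * ε * ∑ k ∈ Finset.range K, volume.real (N (r / 2 ^ k) ∩ cube p (2 * r)) +
          volume.real (N (r / 2 ^ K) ∩ cube p (2 * r)) := by
      refine (Finset.abs_sum_le_sum_abs _ _).trans
        ((Finset.sum_le_sum fun T _ => ih (childCorner p r T) hr hrδ).trans_eq ?_)
      rw [Finset.sum_add_distrib, ← Finset.mul_sum, Finset.sum_comm,
        volume_real_inter_cube_eq_sum (N (r / 2 ^ K)) p hr.le]
      congr 2
      exact Finset.sum_congr rfl fun k _ => (volume_real_inter_cube_eq_sum _ p hr.le).symm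
    have hsecond : |∑ T, (density A (cube (childCorner p r T) r) - density A (cube p (2 * r))) *
        volume.real (S ∩ cube (childCorner p r T) r)| ≤
        2 * n * ε * volume.real (N (2 * r) ∩ cube p (2 * r)) := by
      rw [Set.inter_eq_right.2 h1]
      calc _ ≤ ∑ T, 2 * n * ε * volume.real (S ∩ cube (childCorner p r T) r) := by
            refine (Finset.abs_sum_le_sum_abs _ _).trans (Finset.sum_le_sum fun T _ => ?_)
            rw [abs_mul, abs_of_nonneg measureReal_nonneg]
            gcongr
            exact abs_density_childCorner_sub_density_le h hε p hr hrδ T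
        _ = 2 * n * ε * volume.real (S ∩ cube p (2 * r)) := by
            rw [← Finset.mul_sum, ← volume_real_inter_cube_eq_sum S p hr.le]
        _ ≤ _ := by
            gcongr
            exacts [volume_cube_ne_top _ _, Set.inter_subset_right]
    rw [Finset.sum_range_succ']
    simp only [hpow, pow_zero, div_one]
    refine (abs_add_le _ _).trans ((add_le_add hfirst hsecond).trans_eq ?_)
    ring

/-- If the cubes of sidelength `L / 2 ^ k` that meet both `S` and its complement occupy a volume at
most `M / 2 ^ k`, the density of `A` in `S` can be read off from any cube containing `S`. -/
theorem abs_volume_real_inter_sub_le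
    (h : ∀ a b l, Consecutive a b l → l ≤ δ → |density A (cube a l) - density A (cube b l)| ≤ ε)
    (hε : 0 ≤ ε) {S : Set (EuclideanSpace ℝ (Fin n))} {N : ℝ → Set (EuclideanSpace ℝ (Fin n))}
    (hN : ∀ p s, 0 < s → cube p s ⊆ S ∨ Disjoint (cube p s) S ∨ cube p s ⊆ N s)
    {p : EuclideanSpace ℝ (Fin n)} {L M : ℝ} (hL : 0 < L) (hLδ : L ≤ δ) (hM : 0 ≤ M)
    (hNM : ∀ k : ℕ, volume.real (N (L / 2 ^ k) ∩ cube p L) ≤ M / 2 ^ k) (hS : S ⊆ cube p L) :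
    |volume.real (A ∩ S) - density A (cube p L) * volume.real S| ≤ 4 * n * ε * M := by
  have hD : discrepancy A S p L =
      volume.real (A ∩ S) - density A (cube p L) * volume.real S := by
    rw [discrepancy, Set.inter_assoc, Set.inter_eq_left.2 hS]
  rw [← hD]
  have hbound (K : ℕ) : |discrepancy A S p L| ≤ 4 * n * ε * M + M * (1 / 2) ^ K := by
    have hgeom : ∑ k ∈ Finset.range K, (1 / 2 : ℝ) ^ k ≤ 2 := sum_geometric_two_le K
    calc _ ≤ _ := abs_discrepancy_le_sum h hε hN K p hL hLδ
      _ ≤ 2 * n * ε * ∑ k ∈ Finset.range K, M * (1 / 2) ^ k + M * (1 / 2) ^ K := by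
          gcongr with k
          · simpa [div_eq_mul_inv] using hNM k
          · simpa [div_eq_mul_inv] using hNM K
      _ ≤ 2 * n * ε * (M * 2) + M * (1 / 2) ^ K := by
          rw [← Finset.mul_sum]
          gcongr
      _ = _ := by ring
  have hlim : Tendsto (fun K : ℕ => 4 * n * ε * M + M * (1 / 2 : ℝ) ^ K) atTop
      (𝓝 (4 * n * ε * M + M * 0)) :=
    tendsto_const_nhds.add ((tendsto_pow_atTop_nhds_zero_of_lt_one (by norm_num)
      (by norm_num)).const_mul M)
  simpa using ge_of_tendsto' hlim hbound

/-! ### Bounds for the Jacobian of a bilipschitz map -/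

theorem abs_det_le_pow {T : EuclideanSpace ℝ (Fin n) →L[ℝ] EuclideanSpace ℝ (Fin n)} (hC : 0 ≤ C)
    (h : ∀ v, ‖T v‖ ≤ C * ‖v‖) : |T.det| ≤ C ^ n := by
  have hsub : (T : EuclideanSpace ℝ (Fin n) →ₗ[ℝ] EuclideanSpace ℝ (Fin n)) ''
      Metric.closedBall 0 1 ⊆ Metric.closedBall 0 C := by
    rintro _ ⟨x, hx, rfl⟩
    rw [mem_closedBall_zero_iff] at hx ⊢
    exact (h x).trans (mul_le_of_le_one_right hC hx)
  have hvol := measure_mono (μ := volume) hsub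
  rw [Measure.addHaar_image_linearMap, Measure.addHaar_closedBall _ _ zero_le_one,
    Measure.addHaar_closedBall _ _ hC] at hvol
  simp only [one_pow, ENNReal.ofReal_one, one_mul, finrank_euclideanSpace, Fintype.card_fin] at hvol
  have hvol' := (ENNReal.mul_le_mul_iff_left
    (Metric.measure_ball_pos volume (0 : EuclideanSpace ℝ (Fin n)) one_pos).ne'
    measure_ball_lt_top.ne).1 hvol
  exact (ENNReal.ofReal_le_ofReal_iff (by positivity)).1 hvol'

theorem inv_pow_le_abs_det (T : EuclideanSpace ℝ (Fin n) ≃L[ℝ] EuclideanSpace ℝ (Fin n))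
    (hC : 0 < C) (h : ∀ v, C⁻¹ * ‖v‖ ≤ ‖T v‖) :
    (C ^ n)⁻¹ ≤ |(T : EuclideanSpace ℝ (Fin n) →L[ℝ] EuclideanSpace ℝ (Fin n)).det| := by
  have h1 : |(T.symm : EuclideanSpace ℝ (Fin n) →L[ℝ] EuclideanSpace ℝ (Fin n)).det| ≤ C ^ n := by
    refine abs_det_le_pow hC.le fun v => ?_
    have := h (T.symm v)
    rw [T.apply_symm_apply, inv_mul_le_iff₀ hC] at this
    exact this
  have h2 : (T : EuclideanSpace ℝ (Fin n) →L[ℝ] EuclideanSpace ℝ (Fin n)).det *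
      (T.symm : EuclideanSpace ℝ (Fin n) →L[ℝ] EuclideanSpace ℝ (Fin n)).det = 1 :=
    LinearEquiv.det_mul_det_symm T.toLinearEquiv
  have h3 : |(T : EuclideanSpace ℝ (Fin n) →L[ℝ] EuclideanSpace ℝ (Fin n)).det| *
      |(T.symm : EuclideanSpace ℝ (Fin n) →L[ℝ] EuclideanSpace ℝ (Fin n)).det| = 1 := by
    rw [← abs_mul, h2, abs_one]
  rw [inv_le_iff_one_le_mul₀ (by positivity)]
  calc (1 : ℝ) = _ := h3.symm
    _ ≤ _ := by gcongr

theorem norm_fderiv_apply_bounds (hC : 0 < C)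
    (hφ : ∀ x y, C⁻¹ * ‖x - y‖ ≤ ‖φ x - φ y‖ ∧ ‖φ x - φ y‖ ≤ C * ‖x - y‖)
    {x : EuclideanSpace ℝ (Fin n)} (hd : DifferentiableAt ℝ φ x) (v : EuclideanSpace ℝ (Fin n)) :
    C⁻¹ * ‖v‖ ≤ ‖fderiv ℝ φ x v‖ ∧ ‖fderiv ℝ φ x v‖ ≤ C * ‖v‖ := by
  have hlim := (hd.hasFDerivAt.lim v (c := fun m : ℕ => (m : ℝ)) (l := atTop)
    (by simpa using tendsto_natCast_atTop_atTop (R := ℝ))).norm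
  have hev : ∀ᶠ m : ℕ in atTop, C⁻¹ * ‖v‖ ≤ ‖(m : ℝ) • (φ (x + (m : ℝ)⁻¹ • v) - φ x)‖ ∧
      ‖(m : ℝ) • (φ (x + (m : ℝ)⁻¹ • v) - φ x)‖ ≤ C * ‖v‖ := by
    filter_upwards [eventually_gt_atTop 0] with m hm
    have hm' : (0 : ℝ) < m := by exact_mod_cast hm
    obtain ⟨h1, h2⟩ := hφ (x + (m : ℝ)⁻¹ • v) x
    rw [add_sub_cancel_left, norm_smul, norm_inv, Real.norm_of_nonneg hm'.le] at h1 h2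
    rw [norm_smul, Real.norm_of_nonneg hm'.le]
    constructor
    · calc C⁻¹ * ‖v‖ = m * (C⁻¹ * ((m : ℝ)⁻¹ * ‖v‖)) := by field_simp
        _ ≤ _ := by gcongr
    · calc _ ≤ m * (C * ((m : ℝ)⁻¹ * ‖v‖)) := by gcongr
        _ = _ := by field_simp
  exact ⟨ge_of_tendsto hlim (hev.mono fun _ h => h.1), le_of_tendsto hlim (hev.mono fun _ h => h.2)⟩

/-- The differential of a bilipschitz map, as a linear automorphism. -/
theorem exists_equiv_fderiv (hC : 0 < C)
    (hφ : ∀ x y, C⁻¹ * ‖x - y‖ ≤ ‖φ x - φ y‖ ∧ ‖φ x - φ y‖ ≤ C * ‖x - y‖)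
    (hd : Differentiable ℝ φ) (x : EuclideanSpace ℝ (Fin n)) :
    ∃ T : EuclideanSpace ℝ (Fin n) ≃L[ℝ] EuclideanSpace ℝ (Fin n),
      (T : EuclideanSpace ℝ (Fin n) →L[ℝ] EuclideanSpace ℝ (Fin n)) = fderiv ℝ φ x := by
  have hinj : Function.Injective
      (fderiv ℝ φ x : EuclideanSpace ℝ (Fin n) →ₗ[ℝ] EuclideanSpace ℝ (Fin n)) := by
    rw [injective_iff_map_eq_zero]
    intro v hv
    have h1 := (norm_fderiv_apply_bounds hC hφ (hd x) v).1
    rw [show fderiv ℝ φ x v = 0 from hv, norm_zero] at h1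
    rw [← norm_le_zero_iff]
    exact nonpos_of_mul_nonpos_right h1 (by positivity)
  refine ⟨(LinearEquiv.ofInjectiveEndo _ hinj).toContinuousLinearEquiv, ?_⟩
  ext v
  rfl

theorem abs_jacobian_bounds (hC : 0 < C)
    (hφ : ∀ x y, C⁻¹ * ‖x - y‖ ≤ ‖φ x - φ y‖ ∧ ‖φ x - φ y‖ ≤ C * ‖x - y‖)
    (hd : Differentiable ℝ φ) (x : EuclideanSpace ℝ (Fin n)) :
    (C ^ n)⁻¹ ≤ |jacobian φ x| ∧ |jacobian φ x| ≤ C ^ n := by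
  obtain ⟨T, hT⟩ := exists_equiv_fderiv hC hφ hd x
  refine ⟨?_, abs_det_le_pow hC.le fun v => (norm_fderiv_apply_bounds hC hφ (hd x) v).2⟩
  rw [jacobian, ← hT]
  refine inv_pow_le_abs_det T hC fun v => ?_
  have := (norm_fderiv_apply_bounds hC hφ (hd x) v).1
  rwa [← hT] at this

theorem injective_of_bilipschitz (hC : 0 < C)
    (hφ : ∀ x y, C⁻¹ * ‖x - y‖ ≤ ‖φ x - φ y‖ ∧ ‖φ x - φ y‖ ≤ C * ‖x - y‖) :
    Function.Injective φ := by
  intro x y hxy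
  have h1 := (hφ x y).1
  rw [hxy, sub_self, norm_zero] at h1
  rw [← sub_eq_zero, ← norm_le_zero_iff]
  exact nonpos_of_mul_nonpos_right h1 (by positivity)

/-! ### The inverse map -/

/-- The range is closed by completeness, and open by the inverse function theorem. -/
theorem surjective_of_bilipschitz (hC : 0 < C)
    (hφ : ∀ x y, C⁻¹ * ‖x - y‖ ≤ ‖φ x - φ y‖ ∧ ‖φ x - φ y‖ ≤ C * ‖x - y‖)
    (hφ1 : ContDiff ℝ 1 φ) : Function.Surjective φ := by
  have hlip : LipschitzWith C.toNNReal φ := LipschitzWith.of_dist_le_mul fun x y => by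
    rw [dist_eq_norm, dist_eq_norm, Real.coe_toNNReal C hC.le]
    exact (hφ x y).2
  have hanti : AntilipschitzWith C.toNNReal φ := AntilipschitzWith.of_le_mul_dist fun x y => by
    rw [dist_eq_norm, dist_eq_norm, Real.coe_toNNReal C hC.le, ← inv_mul_le_iff₀ hC]
    exact (hφ x y).1
  choose T hT using exists_equiv_fderiv hC hφ (hφ1.differentiable one_ne_zero)
  have hopen : IsOpenMap φ := isOpenMap_of_hasStrictFDerivAt_equiv (f' := T) fun x => by
    rw [hT]
    exact hφ1.hasStrictFDerivAt one_ne_zero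
  rw [← Set.range_eq_univ]
  exact IsClopen.eq_univ
    ⟨(hanti.isClosedEmbedding hlip.uniformContinuous).isClosed_range, hopen.isOpen_range⟩
    (Set.range_nonempty φ)

/-- The inverse of `φ` satisfies all the hypotheses made on `φ`; its Jacobian is the reciprocal of a
uniformly continuous function that is bounded away from zero. -/
theorem exists_inverse (hφ : IsBilipschitz φ) (hφ1 : ContDiff ℝ 1 φ)
    (hJ : UniformContinuous (jacobian φ)) :
    ∃ ψ : EuclideanSpace ℝ (Fin n) → EuclideanSpace ℝ (Fin n),
      (∀ x, ψ (φ x) = x) ∧ (∀ y, φ (ψ y) = y) ∧ IsBilipschitz ψ ∧ ContDiff ℝ 1 ψ ∧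
        UniformContinuous (jacobian ψ) := by
  obtain ⟨C, hC1, hC⟩ := hφ
  have hC0 : 0 < C := by linarith
  have hd := hφ1.differentiable one_ne_zero
  obtain ⟨ψ, hl, hr⟩ := Function.bijective_iff_has_inverse.1
    ⟨injective_of_bilipschitz hC0 hC, surjective_of_bilipschitz hC0 hC hφ1⟩
  have hψ (x y : EuclideanSpace ℝ (Fin n)) :
      C⁻¹ * ‖x - y‖ ≤ ‖ψ x - ψ y‖ ∧ ‖ψ x - ψ y‖ ≤ C * ‖x - y‖ := by
    have := hC (ψ x) (ψ y)
    rw [hr, hr] at this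
    exact ⟨(inv_mul_le_iff₀ hC0).2 this.2, (inv_mul_le_iff₀ hC0).1 this.1⟩
  have hψlip : LipschitzWith C.toNNReal ψ := LipschitzWith.of_dist_le_mul fun x y => by
    rw [dist_eq_norm, dist_eq_norm, Real.coe_toNNReal C hC0.le]
    exact (hψ x y).2
  choose T hT using exists_equiv_fderiv hC0 hC hd
  let e : EuclideanSpace ℝ (Fin n) ≃ₜ EuclideanSpace ℝ (Fin n) :=
    { toFun := φ
      invFun := ψ
      left_inv := hl
      right_inv := hr
      continuous_toFun := hφ1.continuous
      continuous_invFun := hψlip.continuous }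
  have hψ1 : ContDiff ℝ 1 ψ :=
    e.contDiff_symm (f₀' := T) (fun x => by rw [hT]; exact (hd x).hasFDerivAt) hφ1
  refine ⟨ψ, hl, hr, ⟨C, hC1, hψ⟩, hψ1, ?_⟩
  have hmul (y : EuclideanSpace ℝ (Fin n)) : jacobian φ (ψ y) * jacobian ψ y = 1 := by
    have h1 : HasFDerivAt (φ ∘ ψ) ((fderiv ℝ φ (ψ y)).comp (fderiv ℝ ψ y)) y :=
      (hd (ψ y)).hasFDerivAt.comp y (hψ1.differentiable one_ne_zero y).hasFDerivAt
    have h2 : φ ∘ ψ = id := funext hr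
    rw [h2] at h1
    have h3 := h1.unique (hasFDerivAt_id y)
    have h4 := congrArg ContinuousLinearMap.det h3
    have h5 : (ContinuousLinearMap.id ℝ (EuclideanSpace ℝ (Fin n))).det = 1 := LinearMap.det_id
    rw [h5] at h4
    rw [← h4]
    exact (LinearMap.det_comp _ _).symm
  have hJψ : jacobian ψ = fun y => (jacobian φ (ψ y))⁻¹ :=
    funext fun y => eq_inv_of_mul_eq_one_right (hmul y)
  rw [hJψ, Metric.uniformContinuous_iff]
  intro ε hε
  obtain ⟨δ, hδ, hδ'⟩ := Metric.uniformContinuous_iff.1 (hJ.comp hψlip.uniformContinuous)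
    (ε / (C ^ n) ^ 2) (by positivity)
  refine ⟨δ, hδ, fun x y hxy => ?_⟩
  have h1 := hδ' hxy
  have hx := (abs_jacobian_bounds hC0 hC hd (ψ x)).1
  have hy := (abs_jacobian_bounds hC0 hC hd (ψ y)).1
  rw [Function.comp_apply, Function.comp_apply, Real.dist_eq] at h1
  have hpos : 0 < (C ^ n)⁻¹ := by positivity
  have hx0 : jacobian φ (ψ x) ≠ 0 := abs_pos.1 (hpos.trans_le hx)
  have hy0 : jacobian φ (ψ y) ≠ 0 := abs_pos.1 (hpos.trans_le hy)
  rw [Real.dist_eq, inv_sub_inv hx0 hy0, abs_div, abs_mul, abs_sub_comm,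
    div_lt_iff₀ (by positivity)]
  calc |jacobian φ (ψ x) - jacobian φ (ψ y)| < ε / (C ^ n) ^ 2 := h1
    _ = ε * ((C ^ n)⁻¹ * (C ^ n)⁻¹) := by field_simp
    _ ≤ _ := by gcongr

/-! ### Volumes of images -/

/-- Change of variables for null measurable sets: if `c₁ ≤ |J φ| ≤ c₂` on `E`, the map multiplies the
volume of `E` by a factor between `c₁` and `c₂`. -/
theorem volume_real_image_bounds (hd : Differentiable ℝ φ) (hinj : Function.Injective φ)
    {E : Set (EuclideanSpace ℝ (Fin n))} (hE : NullMeasurableSet E volume) (hE' : volume E ≠ ∞)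
    {c₁ c₂ : ℝ} (hc₁ : 0 ≤ c₁) (hc₂ : 0 ≤ c₂)
    (h : ∀ x ∈ E, c₁ ≤ |jacobian φ x| ∧ |jacobian φ x| ≤ c₂) :
    c₁ * volume.real E ≤ volume.real (φ '' E) ∧ volume.real (φ '' E) ≤ c₂ * volume.real E ∧
      volume (φ '' E) ≠ ∞ := by
  -- A measurable subset of full measure has an image of full measure.
  obtain ⟨F, hFE, hF, hFE'⟩ := hE.exists_measurable_subset_ae_eq
  have himg : volume (φ '' E) = volume (φ '' F) := by
    refine le_antisymm ?_ (measure_mono (Set.image_mono hFE))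
    have h0 : volume (φ '' (E \ F)) = 0 :=
      addHaar_image_eq_zero_of_differentiableOn_of_addHaar_eq_zero volume hd.differentiableOn
        (ae_le_set.1 hFE'.symm.le)
    calc volume (φ '' E) ≤ volume (φ '' F ∪ φ '' (E \ F)) := by
          rw [← Set.image_union, Set.union_sdiff_cancel hFE]
      _ ≤ volume (φ '' F) + volume (φ '' (E \ F)) := measure_union_le _ _
      _ = volume (φ '' F) := by rw [h0, add_zero]
  have hvol := lintegral_abs_det_fderiv_eq_addHaar_image volume hF
    (fun x _ => (hd x).hasFDerivAt.hasFDerivWithinAt) hinj.injOn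
  have hlow : ENNReal.ofReal c₁ * volume E ≤ volume (φ '' E) := by
    rw [himg, ← hvol, ← measure_congr hFE', ← setLIntegral_const]
    exact setLIntegral_mono' hF fun x hx => ENNReal.ofReal_le_ofReal (h x (hFE hx)).1
  have hup : volume (φ '' E) ≤ ENNReal.ofReal c₂ * volume E := by
    rw [himg, ← hvol, ← measure_congr hFE', ← setLIntegral_const]
    exact setLIntegral_mono' hF fun x hx => ENNReal.ofReal_le_ofReal (h x (hFE hx)).2
  have hfin : volume (φ '' E) ≠ ∞ := ne_top_of_le_ne_top (by finiteness) hup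
  refine ⟨?_, ?_, hfin⟩
  · have := ENNReal.toReal_mono hfin hlow
    rwa [ENNReal.toReal_mul, ENNReal.toReal_ofReal hc₁] at this
  · have := ENNReal.toReal_mono (by finiteness) hup
    rwa [ENNReal.toReal_mul, ENNReal.toReal_ofReal hc₂] at this

/-! ### Densities in cubes and in their images -/

/-- Both smoothness conditions in `ε`-`δ` form; `F a l` stands for the density of the set in the
cube with lower corner `a` and sidelength `l`, or in its image. -/
theorem tendsto_iSup_consecutive_iff (F : EuclideanSpace ℝ (Fin n) → ℝ → ℝ) :
    Tendsto (fun δ : ℝ => ⨆ (a : EuclideanSpace ℝ (Fin n)) (b : EuclideanSpace ℝ (Fin n)) (l : ℝ)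
      (_ : Consecutive a b l) (_ : l ≤ δ), ENNReal.ofReal |F a l - F b l|) (𝓝[>] 0) (𝓝 0) ↔
    ∀ ε > 0, ∃ δ > 0, ∀ a b l, Consecutive a b l → l ≤ δ → |F a l - F b l| ≤ ε := by
  rw [ENNReal.tendsto_nhds_zero]
  constructor
  · intro h ε hε
    obtain ⟨δ, hδ, hδ0⟩ :=
      ((h (ENNReal.ofReal ε) (ENNReal.ofReal_pos.2 hε)).and self_mem_nhdsWithin).exists
    refine ⟨δ, hδ0, fun a b l hc hl => ?_⟩
    simp only [iSup_le_iff] at hδ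
    exact (ENNReal.ofReal_le_ofReal_iff hε.le).1 (hδ a b l hc hl)
  · intro h ε hε
    rcases eq_or_ne ε ∞ with rfl | hε'
    · exact Eventually.of_forall fun _ => le_top
    obtain ⟨δ, hδ0, hδ⟩ := h ε.toReal (ENNReal.toReal_pos hε.ne' hε')
    filter_upwards [Ioc_mem_nhdsGT hδ0] with r hr
    simp only [iSup_le_iff]
    intro a b l hc hl
    exact ENNReal.ofReal_le_of_le_toReal (hδ a b l hc (hl.trans hr.2))

/-- On a small cube the Jacobian is nearly constant, so the density of `A` in the image is nearly
that of `φ ⁻¹' A` in the cube. -/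
theorem exists_abs_density_image_sub_le (hφ : IsBilipschitz φ) (hφ1 : ContDiff ℝ 1 φ)
    (hJ : UniformContinuous (jacobian φ)) (hA : NullMeasurableSet (φ ⁻¹' A) volume)
    {ε : ℝ} (hε : 0 < ε) :
    ∃ δ > 0, ∀ a l, 0 < l → l ≤ δ →
      |density A (φ '' cube a l) - density (φ ⁻¹' A) (cube a l)| ≤ ε := by
  obtain ⟨C, hC1, hC⟩ := hφ
  have hC0 : 0 < C := by linarith
  have hd := hφ1.differentiable one_ne_zero
  have hinj := injective_of_bilipschitz hC0 hC
  -- The second term keeps `|J φ a| - η` nonnegative.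
  set η : ℝ := min (ε / (2 * C ^ n)) (C ^ n)⁻¹
  have hη0 : 0 < η := by positivity
  obtain ⟨r, hr, hr'⟩ := Metric.uniformContinuous_iff.1 hJ η hη0
  refine ⟨r / (√n + 1), by positivity, fun a l hl hlr => ?_⟩
  set m : ℝ := |jacobian φ a| with hm
  have ha : a ∈ cube a l := fun i => ⟨le_rfl, by linarith⟩
  have hosc : ∀ x ∈ cube a l, m - η ≤ |jacobian φ x| ∧ |jacobian φ x| ≤ m + η := by
    intro x hx
    have hdist : dist x a < r := by
      rw [dist_eq_norm]
      calc ‖x - a‖ ≤ √n * l := norm_sub_le_of_mem_cube hx ha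
        _ < (√n + 1) * l := by nlinarith
        _ ≤ r := by rw [le_div_iff₀ (by positivity)] at hlr; linarith
    have h1 := hr' hdist
    rw [Real.dist_eq] at h1
    have h2 := (abs_abs_sub_abs_le (jacobian φ x) (jacobian φ a)).trans h1.le
    rw [abs_le] at h2
    constructor <;> linarith [h2.1, h2.2]
  have hm0 : 0 ≤ m - η := by
    have h1 := (abs_jacobian_bounds hC0 hC hd a).1
    have h2 : η ≤ (C ^ n)⁻¹ := min_le_right _ _
    linarith
  have hQ := volume_real_image_bounds hd hinj (measurableSet_cube a l).nullMeasurableSet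
    (volume_cube_ne_top a l) hm0 (by linarith) hosc
  have hQ' := volume_real_image_bounds hd hinj (measurableSet_cube a l).nullMeasurableSet
    (volume_cube_ne_top a l) (by positivity) (by positivity)
    fun x _ => abs_jacobian_bounds hC0 hC hd x
  have hE := volume_real_image_bounds hd hinj
    (hA.inter (measurableSet_cube a l).nullMeasurableSet)
    (volume_inter_cube_ne_top _ a l) hm0 (by linarith) fun x hx => hosc x hx.2
  rw [Set.image_preimage_inter] at hE
  have hv : 0 < volume.real (cube a l) := by
    rw [volume_real_cube a hl.le]; positivity
  have huv : volume.real (φ ⁻¹' A ∩ cube a l) ≤ volume.real (cube a l) :=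
    measureReal_mono Set.inter_subset_right (volume_cube_ne_top a l)
  have hu : 0 ≤ volume.real (φ ⁻¹' A ∩ cube a l) := measureReal_nonneg
  have hCn : 0 < C ^ n := by positivity
  have hyv : volume.real (cube a l) ≤ C ^ n * volume.real (φ '' cube a l) :=
    (inv_mul_le_iff₀ hCn).1 hQ'.1
  have hηC : 2 * η * C ^ n ≤ ε := by
    have : η ≤ ε / (2 * C ^ n) := min_le_left _ _
    rw [le_div_iff₀ (by positivity)] at this
    linarith
  rw [density, density]
  generalize volume.real (φ ⁻¹' A ∩ cube a l) = u at *
  generalize volume.real (cube a l) = v at *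
  generalize volume.real (φ '' cube a l) = y at *
  generalize volume.real (A ∩ φ '' cube a l) = x at *
  have hy : 0 < y := pos_of_mul_pos_right (hv.trans_le hyv) hCn.le
  have hx1 : |x - m * u| ≤ η * v := by
    have : η * u ≤ η * v := by gcongr
    rw [abs_le]
    constructor <;> linarith [hE.1, hE.2.1]
  have hy1 : |y - m * v| ≤ η * v := by
    rw [abs_le]
    constructor <;> linarith [hQ.1, hQ.2.1]
  rw [div_sub_div _ _ hy.ne' hv.ne', abs_div, abs_of_pos (mul_pos hy hv),
    div_le_iff₀ (mul_pos hy hv)]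
  calc |x * v - y * u| = |(x - m * u) * v - u * (y - m * v)| := by ring_nf
    _ ≤ |(x - m * u) * v| + |u * (y - m * v)| := abs_sub _ _
    _ = |x - m * u| * v + u * |y - m * v| := by
        rw [abs_mul, abs_mul, abs_of_pos hv, abs_of_nonneg hu]
    _ ≤ η * v * v + v * (η * v) := by gcongr
    _ = 2 * η * v * v := by ring
    _ ≤ 2 * η * (C ^ n * y) * v := by gcongr
    _ = (2 * η * C ^ n) * (y * v) := by ring
    _ ≤ ε * (y * v) := by gcongr

/-! ### Smooth sets and images of cubes -/

/-- The shell of width `t` around the boundary of the cube with lower corner `a` and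
sidelength `l`. -/
def cubeShell (a : EuclideanSpace ℝ (Fin n)) (l t : ℝ) : Set (EuclideanSpace ℝ (Fin n)) :=
  cube (WithLp.toLp 2 fun i => a i - t) (l + 2 * t) \
    cube (WithLp.toLp 2 fun i => a i + t) (l - 2 * t)

theorem mem_cubeShell {a x y z : EuclideanSpace ℝ (Fin n)} {l t : ℝ} (hx : x ∈ cube a l)
    (hy : y ∉ cube a l) (hzx : ‖z - x‖ ≤ t) (hzy : ‖z - y‖ ≤ t) : z ∈ cubeShell a l t := by
  refine ⟨fun i => ?_, fun hz => hy fun i => ?_⟩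
  · have h1 := hx i
    have h2 := abs_le.1 ((abs_sub_apply_le z x i).trans hzx)
    rw [Set.mem_Icc] at h1 ⊢
    constructor <;> simp only <;> linarith [h1.1, h1.2, h2.1, h2.2]
  · have h1 := hz i
    have h2 := abs_le.1 ((abs_sub_apply_le z y i).trans hzy)
    rw [Set.mem_Icc] at h1 ⊢
    simp only at h1
    constructor <;> linarith [h1.1, h1.2, h2.1, h2.2]

theorem measurableSet_cubeShell (a : EuclideanSpace ℝ (Fin n)) (l t : ℝ) :
    MeasurableSet (cubeShell a l t) :=
  (measurableSet_cube _ _).diff (measurableSet_cube _ _)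

theorem volume_cubeShell_ne_top (a : EuclideanSpace ℝ (Fin n)) (l t : ℝ) :
    volume (cubeShell a l t) ≠ ∞ :=
  measure_ne_top_of_subset Set.sdiff_subset (volume_cube_ne_top _ _)

theorem volume_real_cubeShell_le (a : EuclideanSpace ℝ (Fin n)) {l t : ℝ} (hl : 0 ≤ l)
    (ht : 0 ≤ t) :
    volume.real (cubeShell a l t) ≤ 4 * t * n * (l + 2 * t) ^ (n - 1) := by
  have hn : 0 ≤ 4 * t * n * (l + 2 * t) ^ (n - 1) := by positivity
  -- The inner cube is empty (or `n = 0`) when its sidelength is negative.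
  have key : volume.real (cubeShell a l t) ≤ (l + 2 * t) ^ n - (max (l - 2 * t) 0) ^ n := by
    rcases le_or_gt 0 (l - 2 * t) with h | h
    · rw [max_eq_left h, cubeShell, measureReal_sdiff _ (measurableSet_cube _ _)
        (volume_cube_ne_top _ _), volume_real_cube _ (by positivity), volume_real_cube _ h]
      intro x hx i
      have := hx i
      simp only [Set.mem_Icc] at this ⊢
      constructor <;> linarith [this.1, this.2]
    · rw [max_eq_right h.le]
      rcases n.eq_zero_or_pos with rfl | hn0
      · have : cubeShell a l t = ∅ := by
          ext x; simp [cubeShell, cube]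
        simp [this]
      · rw [zero_pow hn0.ne', sub_zero, ← volume_real_cube
          (WithLp.toLp 2 fun i => a i - t) (by positivity : 0 ≤ l + 2 * t)]
        exact measureReal_mono Set.sdiff_subset (volume_cube_ne_top _ _)
  have h1 := abs_pow_sub_pow_le (l + 2 * t) (max (l - 2 * t) 0) n
  have h2 : max (l - 2 * t) 0 ≤ l + 2 * t := max_le (by linarith) (by positivity)
  have h3 : l + 2 * t - max (l - 2 * t) 0 ≤ 4 * t := by linarith [le_max_left (l - 2 * t) 0]
  rw [abs_of_nonneg (le_max_right (l - 2 * t) 0), abs_of_nonneg (by positivity : 0 ≤ l + 2 * t),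
    max_eq_left h2, abs_of_nonneg (sub_nonneg.2 h2)] at h1
  calc _ ≤ _ := key.trans (le_abs_self _)
    _ ≤ _ := h1
    _ ≤ _ := by gcongr

/-- A bilipschitz image of a small cube `Q` has nearly the same density as any sufficiently small
cube of comparable size that contains it: the dyadic subcubes of sidelength `s` that meet both
`φ(Q)` and its complement lie in the image of a shell of width comparable to `s`. -/
theorem exists_abs_density_image_sub_density_le (n : ℕ) {C B : ℝ} (hC1 : 1 ≤ C) (hB : 0 < B) :
    ∃ K > 0, ∀ φ ψ : EuclideanSpace ℝ (Fin n) → EuclideanSpace ℝ (Fin n),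
      (∀ x y, C⁻¹ * ‖x - y‖ ≤ ‖φ x - φ y‖ ∧ ‖φ x - φ y‖ ≤ C * ‖x - y‖) → ContDiff ℝ 1 φ →
      (∀ x, φ (ψ x) = x) → ∀ (A : Set (EuclideanSpace ℝ (Fin n))) (δ ε : ℝ), 0 ≤ ε →
      (∀ a b l, Consecutive a b l → l ≤ δ → |density A (cube a l) - density A (cube b l)| ≤ ε) →
      ∀ (a p : EuclideanSpace ℝ (Fin n)) (l : ℝ), 0 < l → B * l ≤ δ →
        φ '' cube a l ⊆ cube p (B * l) →
        |density A (φ '' cube a l) - density A (cube p (B * l))| ≤ K * ε := by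
  have hC0 : 0 < C := by linarith
  set c : ℝ := C * √n with hc
  have hc0 : 0 ≤ c := by positivity
  set K₀ : ℝ := C ^ n * (4 * (c * B) * n * (1 + 2 * (c * B)) ^ (n - 1)) with hK₀
  refine ⟨4 * n * K₀ * C ^ n + 1, by positivity, ?_⟩
  intro φ ψ hφ hφ1 hψ A δ ε hε hA a p l hl hlδ hsub
  have hd := hφ1.differentiable one_ne_zero
  have hinj := injective_of_bilipschitz hC0 hφ
  have hQ := volume_real_image_bounds hd hinj (measurableSet_cube a l).nullMeasurableSet
    (volume_cube_ne_top a l) (by positivity) (by positivity)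
    fun x _ => abs_jacobian_bounds hC0 hφ hd x
  rw [volume_real_cube a hl.le] at hQ
  have hN (q : EuclideanSpace ℝ (Fin n)) (s : ℝ) (_ : 0 < s) : cube q s ⊆ φ '' cube a l ∨
      Disjoint (cube q s) (φ '' cube a l) ∨ cube q s ⊆ φ '' cubeShell a l (c * s) := by
    by_contra! hcon
    obtain ⟨h1, h2, h3⟩ := hcon
    obtain ⟨y, hy, hyS⟩ := Set.not_subset.1 h1
    obtain ⟨x, hx, hxS⟩ := Set.not_disjoint_iff.1 h2
    refine h3 fun z hz => ⟨ψ z, ?_, hψ z⟩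
    obtain ⟨x', hx', rfl⟩ := hxS
    have hdist (w : EuclideanSpace ℝ (Fin n)) (hw : φ w ∈ cube q s) : ‖ψ z - w‖ ≤ c * s := by
      have h4 := (inv_mul_le_iff₀ hC0).1 (hφ (ψ z) w).1
      rw [hψ] at h4
      calc _ ≤ C * ‖z - φ w‖ := h4
        _ ≤ C * (√n * s) := by gcongr; exact norm_sub_le_of_mem_cube hz hw
        _ = c * s := by ring
    exact mem_cubeShell hx' (fun hy' => hyS ⟨ψ y, hy', hψ y⟩) (hdist x' hx)
      (hdist (ψ y) (by rwa [hψ]))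
  have hM (k : ℕ) : volume.real (φ '' cubeShell a l (c * (B * l / 2 ^ k)) ∩ cube p (B * l)) ≤
      K₀ * l ^ n / 2 ^ k := by
    have hsh := volume_real_image_bounds hd hinj
      (measurableSet_cubeShell a l (c * (B * l / 2 ^ k))).nullMeasurableSet
      (volume_cubeShell_ne_top a l _) (by positivity) (by positivity)
      fun x _ => abs_jacobian_bounds hC0 hφ hd x
    have hle : B * l / 2 ^ k ≤ B * l := div_le_self (by positivity) (one_le_pow₀ one_le_two)
    calc _ ≤ volume.real (φ '' cubeShell a l (c * (B * l / 2 ^ k))) :=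
          measureReal_mono Set.inter_subset_left hsh.2.2
      _ ≤ _ := hsh.2.1
      _ ≤ C ^ n * (4 * (c * (B * l / 2 ^ k)) * n *
          (l + 2 * (c * (B * l / 2 ^ k))) ^ (n - 1)) := by
          gcongr
          exact volume_real_cubeShell_le a hl.le (by positivity)
      _ ≤ C ^ n * (4 * (c * (B * l / 2 ^ k)) * n * (l + 2 * (c * (B * l))) ^ (n - 1)) := by
          gcongr
      _ = K₀ * l ^ n / 2 ^ k := by
          rcases n.eq_zero_or_pos with rfl | hn
          · simp [hK₀]
          obtain ⟨m, rfl⟩ : ∃ m, n = m + 1 := ⟨n - 1, by omega⟩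
          rw [hK₀, Nat.add_sub_cancel,
            show l + 2 * (c * (B * l)) = l * (1 + 2 * (c * B)) by ring, mul_pow]
          ring
  have hmain := abs_volume_real_inter_sub_le hA hε
    (N := fun s => φ '' cubeShell a l (c * s)) hN (by positivity) hlδ (by positivity) hM hsub
  have hSpos : 0 < volume.real (φ '' cube a l) := lt_of_lt_of_le (by positivity) hQ.1
  have hSl : l ^ n ≤ C ^ n * volume.real (φ '' cube a l) :=
    (inv_mul_le_iff₀ (by positivity)).1 hQ.1
  refine le_of_mul_le_mul_right ?_ hSpos
  rw [← abs_of_pos hSpos, ← abs_mul, sub_mul, abs_of_pos hSpos, density_mul_volume_real hSpos.ne']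
  calc _ ≤ 4 * n * ε * (K₀ * l ^ n) := hmain
    _ ≤ 4 * n * ε * (K₀ * (C ^ n * volume.real (φ '' cube a l))) := by gcongr
    _ = 4 * n * K₀ * C ^ n * ε * volume.real (φ '' cube a l) := by ring
    _ ≤ (4 * n * K₀ * C ^ n + 1) * ε * volume.real (φ '' cube a l) := by
        gcongr
        linarith

theorem IsSmooth.isSmoothForImages (h : IsSmooth A) (hφ : IsBilipschitz φ)
    (hφ1 : ContDiff ℝ 1 φ) : IsSmoothForImages φ A := by
  obtain ⟨C, hC1, hC⟩ := hφ
  have hC0 : 0 < C := by linarith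
  refine ⟨h.1, (tendsto_iSup_consecutive_iff fun a l => density A (φ '' cube a l)).2 ?_⟩
  have hA := (tendsto_iSup_consecutive_iff fun a l => density A (cube a l)).1 h.2
  obtain ⟨ψ, hψ⟩ := (surjective_of_bilipschitz hC0 hC hφ1).hasRightInverse
  -- The images of two consecutive cubes lie in a cube of sidelength `2 * R * l`.
  set R : ℝ := C * (√n * 2) + 1 with hR
  have hR0 : 0 < R := by positivity
  obtain ⟨K, hK, hK'⟩ := exists_abs_density_image_sub_density_le n hC1
    (by positivity : 0 < 2 * R)
  intro ε hε
  obtain ⟨δ, hδ, hδ'⟩ := hA (ε / (2 * K)) (by positivity)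
  refine ⟨δ / (2 * R), by positivity, fun a b l hab hl => ?_⟩
  rw [le_div_iff₀ (by positivity), mul_comm] at hl
  have hl0 : 0 < l := hab.1
  have hsub (b : EuclideanSpace ℝ (Fin n)) (hb : ∀ i, |a i - b i| ≤ l) :
      φ '' cube b l ⊆ cube (WithLp.toLp 2 fun i => φ a i - R * l) (2 * R * l) := by
    rintro _ ⟨x, hx, rfl⟩ i
    have h1 : ‖x - a‖ ≤ √n * (2 * l) := norm_le_sqrt_mul (by positivity) fun j => by
      have h2 := hx j
      have h3 := abs_le.1 (hb j)
      rw [Set.mem_Icc] at h2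
      rw [PiLp.sub_apply, abs_le]
      constructor <;> linarith [h2.1, h2.2, h3.1, h3.2]
    have h2 : |φ x i - φ a i| ≤ R * l := by
      calc _ ≤ ‖φ x - φ a‖ := abs_sub_apply_le _ _ i
        _ ≤ C * ‖x - a‖ := (hC x a).2
        _ ≤ C * (√n * (2 * l)) := by gcongr
        _ ≤ R * l := by rw [hR]; linarith
    rw [abs_le] at h2
    simp only [Set.mem_Icc]
    constructor <;> linarith [h2.1, h2.2]
  have ha := hK' φ ψ hC hφ1 hψ A δ _ (by positivity) hδ' a _ l hl0 hl
    (hsub a fun i => by simpa using hl0.le)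
  have hb := hK' φ ψ hC hφ1 hψ A δ _ (by positivity) hδ' b _ l hl0 hl (hsub b hab.abs_sub_le)
  rw [abs_sub_comm] at hb
  have hKε : K * (ε / (2 * K)) = ε / 2 := by field_simp
  rw [hKε] at ha hb
  linarith [abs_sub_le (density A (φ '' cube a l))
    (density A (cube (WithLp.toLp 2 fun i => φ a i - R * l) (2 * R * l)))
    (density A (φ '' cube b l))]

theorem isSmooth_preimage_iff_isSmoothForImages (hφ : IsBilipschitz φ) (hφ1 : ContDiff ℝ 1 φ)
    (hJ : UniformContinuous (jacobian φ)) (hA : NullMeasurableSet A volume)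
    (hA' : NullMeasurableSet (φ ⁻¹' A) volume) :
    IsSmooth (φ ⁻¹' A) ↔ IsSmoothForImages φ A := by
  have h1 := tendsto_iSup_consecutive_iff fun a l => density (φ ⁻¹' A) (cube a l)
  have h2 := tendsto_iSup_consecutive_iff fun a l => density A (φ '' cube a l)
  refine ⟨fun h => ⟨hA, h2.2 fun ε hε => ?_⟩, fun h => ⟨hA', h1.2 fun ε hε => ?_⟩⟩
  all_goals
    obtain ⟨δ₁, hδ₁, H₁⟩ := exists_abs_density_image_sub_le hφ hφ1 hJ hA'
      (by positivity : 0 < ε / 3)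
  · obtain ⟨δ₂, hδ₂, H₂⟩ := h1.1 h.2 (ε / 3) (by positivity)
    refine ⟨min δ₁ δ₂, by positivity, fun a b l hab hl => ?_⟩
    have e1 := abs_le.1 (H₁ a l hab.1 (hl.trans (min_le_left _ _)))
    have e2 := abs_le.1 (H₁ b l hab.1 (hl.trans (min_le_left _ _)))
    have e3 := abs_le.1 (H₂ a b l hab (hl.trans (min_le_right _ _)))
    rw [abs_le]
    constructor <;> linarith [e1.1, e1.2, e2.1, e2.2, e3.1, e3.2]
  · obtain ⟨δ₂, hδ₂, H₂⟩ := h2.1 h.2 (ε / 3) (by positivity)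
    refine ⟨min δ₁ δ₂, by positivity, fun a b l hab hl => ?_⟩
    have e1 := abs_le.1 (H₁ a l hab.1 (hl.trans (min_le_left _ _)))
    have e2 := abs_le.1 (H₁ b l hab.1 (hl.trans (min_le_left _ _)))
    have e3 := abs_le.1 (H₂ a b l hab (hl.trans (min_le_right _ _)))
    rw [abs_le]
    constructor <;> linarith [e1.1, e1.2, e2.1, e2.2, e3.1, e3.2]

theorem nullMeasurableSet_preimage (hφ : Continuous φ) (hψ : Differentiable ℝ ψ)
    (hl : ∀ x, ψ (φ x) = x) (hA : NullMeasurableSet A volume) :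
    NullMeasurableSet (φ ⁻¹' A) volume := by
  refine hA.preimage ⟨hφ.measurable, Measure.AbsolutelyContinuous.mk fun s hs hs0 => ?_⟩
  rw [Measure.map_apply hφ.measurable hs]
  refine measure_mono_null (t := ψ '' s) (fun x hx => ⟨φ x, hx, hl x⟩)
    (addHaar_image_eq_zero_of_differentiableOn_of_addHaar_eq_zero volume hψ.differentiableOn hs0)

end SmoothSets


theorem theorem2 (n : ℕ) (φ : EuclideanSpace ℝ (Fin n) → EuclideanSpace ℝ (Fin n))
    (hφ : SmoothSets.IsBilipschitz φ) (hφ1 : ContDiff ℝ 1 φ)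
    (hJ : UniformContinuous (SmoothSets.jacobian φ))
    (A : Set (EuclideanSpace ℝ (Fin n))) (hA : NullMeasurableSet A volume) :
    List.TFAE [
      SmoothSets.IsSmooth A,
      SmoothSets.IsSmooth (φ ⁻¹' A),
      SmoothSets.IsSmoothForImages φ A] := by
  obtain ⟨ψ, hl, hr, hψ, hψ1, hJψ⟩ := SmoothSets.exists_inverse hφ hφ1 hJ
  have hA' : NullMeasurableSet (φ ⁻¹' A) volume :=
    SmoothSets.nullMeasurableSet_preimage hφ1.continuous (hψ1.differentiable one_ne_zero) hl hA
  have hψA : ψ ⁻¹' (φ ⁻¹' A) = A := by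
    ext y
    simp [hr]
  tfae_have 1 → 3 := fun h => h.isSmoothForImages hφ hφ1
  tfae_have 3 ↔ 2 := (SmoothSets.isSmooth_preimage_iff_isSmoothForImages hφ hφ1 hJ hA hA').symm
  tfae_have 2 → 1 := fun h => by
    have h1 := SmoothSets.isSmooth_preimage_iff_isSmoothForImages hψ hψ1 hJψ hA' (hψA.symm ▸ hA)
    rw [hψA] at h1
    exact h1.2 (h.isSmoothForImages hψ hψ1)
  tfae_finish
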